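/- Let $\mathbb{R}^d$ be equipped with an arbitrary norm $\|\cdot\|$ and Lebesgue measure $dx$ (equivalently, take a finite-dimensional real normed space with a Haar measure), and put $d(x,x')=\|x-x'\|$. Let $\mathcal{M}(\mathbb{R}^d)$ be the Borel sets. Let $\nu$ be a Borel probability measure on $\mathbb{R}^d\times\{0,1\}$, $w_y=\nu(\mathbb{R}^d\times\{y\})$ for $y\in\{0,1\}$, and let $\rho_0,\rho_1$ be probability densities on $\mathbb{R}^d$ such that, for each $y$ with $w_y>0$, the conditional law of $x$ given the label $y$ is $\rho_y\,dx$. Let $\varepsilon\ge 0$. For $A\in\mathcal{M}(\mathbb{R}^d)$ the adversarial risk of the classifier $\mathbf 1_A$ is \[ R_\varepsilon(\mathbf 1_A)=\sup_{g}\int \mathbf 1_{\{\mathbf 1_A(g(x,y))\ne y\}}\,d\nu(x,y), \] the supremum being over all Borel maps $g:\mathbb{R}^d\times\{0,1\}\to\mathbb{R}^d$ with $d(g(x,y),x)\le\varepsilon$ for all $(x,y)$. Let $\tilde d_A(x)=d(x,A)$ for $x\notin A$ and $\tilde d_A(x)=-d(x,A^c)$ for $x\in A$ (with $d(x,\emptyset)=+\infty$),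 and for $s\in\mathbb{R}$ let $A^{s}=\{x:\tilde d_A(x)\le s\}$. Let $\nu^S$ be the image of $\nu$ under $(x,y)\mapsto(x,1-y)$, let $\Gamma(\nu,\nu^S)$ be the set of couplings of $\nu$ and $\nu^S$, and let $c_\varepsilon(z_1,z_2)=1$ if $d(x_1,x_2)>2\varepsilon$ or $y_1\neq y_2$, and $c_\varepsilon(z_1,z_2)=0$ otherwise, where $z_i=(x_i,y_i)$. If $\varepsilon>0$, then a set $A\in\mathcal{M}(\mathbb{R}^d)$ minimizes $B\mapsto R_\varepsilon(\mathbf 1_B)$ over $\mathcal{M}(\mathbb{R}^d)$ if and only if it maximizes \[ B\mapsto w_1\int_{B^{-\varepsilon}}\rho_1\,dx-w_0\int_{B^{\varepsilon}}\rho_0\,dx \] over $\mathcal{M}(\mathbb{R}^d)$. Moreover, for every $\varepsilon\ge 0$, \[ \inf_{A\in\mathcal{M}(\mathbb{R}^d)}R_\varepsilon(\mathbf 1_A)=\frac12-\frac12\inf_{\pi\in\Gamma(\nu,\nu^S)}\int c_\varepsilon(z_1,z_2)\,d\pi(z_1,z_2). \] -/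

import Mathlib

open MeasureTheory Set
open scoped ENNReal

namespace AdvRisk

noncomputable section

/-- The 0-1 loss of a prediction `u` against a label `y` in `{0, 1}`. -/
def zeroOneLoss (u : ℝ) (y : Fin 2) : ℝ :=
  if u = ((y : ℕ) : ℝ) then 0 else 1

/-- The indicator function of `A`, seen as a binary classifier. -/
def classifier {E : Type*} (A : Set E) : E → ℝ :=
  A.indicator (fun _ => 1)

/-- The admissible actions of an adversary of power `ε`: Borel maps `g (x, y)` that move each
feature vector `x`, with knowledge of its label `y`, by a distance of at most `ε`. -/
def Attacks (E : Type*) [PseudoMetricSpace E] [MeasurableSpace E] (ε : ℝ) :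
    Set (E × Fin 2 → E) :=
  {g | Measurable g ∧ ∀ z, dist (g z) z.1 ≤ ε}

/-- The adversarial (robust) risk
`R_ε(f) = sup_g ∫ ℓ(f(g(x,y)), y) dν(x,y)` for the 0-1 loss. -/
def robustRisk {E : Type*} [PseudoMetricSpace E] [MeasurableSpace E]
    (ν : Measure (E × Fin 2)) (ε : ℝ) (f : E → ℝ) : ℝ :=
  ⨆ g : Attacks E ε, ∫ z, zeroOneLoss (f (g.1 z)) z.2 ∂ν

open Classical in
/-- The signed distance to `A`: `d(x, A)` outside of `A` and `-d(x, Aᶜ)` inside. It takes values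
in the extended reals, since the distance to the empty set is `+∞`. -/
def signedDistTo {E : Type*} [PseudoMetricSpace E] (A : Set E) (x : E) : EReal :=
  if x ∈ A then -((Metric.infEDist x Aᶜ : ℝ≥0∞) : EReal)
  else ((Metric.infEDist x A : ℝ≥0∞) : EReal)

/-- The sublevel set `A^s` of the signed distance: a dilation of `A` for `s > 0`, an erosion of
`A` for `s < 0`. -/
def offset {E : Type*} [PseudoMetricSpace E] (A : Set E) (s : ℝ) : Set E :=
  {x | signedDistTo A x ≤ (s : EReal)}

/-- The probability `w_y` of the label `y`. -/
def labelWeight {E : Type*} [MeasurableSpace E] (ν : Measure (E × Fin 2)) (y : Fin 2) : ℝ :=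
  ν.real (Prod.snd ⁻¹' {y})

/-- `ρ` is a probability density with respect to `vol`, and, if the label `y` has positive
probability, the conditional law of the feature vector given that label is `ρ dvol`. -/
structure IsCondDensity {E : Type*} [MeasurableSpace E] (vol : Measure E)
    (ν : Measure (E × Fin 2)) (y : Fin 2) (ρ : E → ℝ) : Prop where
  measurable : Measurable ρ
  nonneg : ∀ x, 0 ≤ ρ x
  integral_eq_one : ∫ x, ρ x ∂vol = 1
  condLaw : ν (Prod.snd ⁻¹' {y}) ≠ 0 →
    (ProbabilityTheory.cond ν (Prod.snd ⁻¹' {y})).map Prod.fst =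
      vol.withDensity (fun x => ENNReal.ofReal (ρ x))

/-- The data distribution with the two labels swapped. -/
def swapLabels {E : Type*} [MeasurableSpace E] (ν : Measure (E × Fin 2)) :
    Measure (E × Fin 2) :=
  ν.map (fun z => (z.1, Equiv.swap 0 1 z.2))

/-- The set `Γ(μ, μ')` of couplings. -/
def Couplings {Z : Type*} [MeasurableSpace Z] (μ μ' : Measure Z) : Set (Measure (Z × Z)) :=
  {π | π.map Prod.fst = μ ∧ π.map Prod.snd = μ'}

open Classical in
/-- The cost `c_ε`, equal to `1` if `d(x₁, x₂) > 2ε` or `y₁ ≠ y₂`, and to `0` otherwise. -/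
def cost {E : Type*} [PseudoMetricSpace E] (ε : ℝ) (p : (E × Fin 2) × (E × Fin 2)) : ℝ :=
  if 2 * ε < dist p.1.1 p.2.1 ∨ p.1.2 ≠ p.2.2 then 1 else 0

end

end AdvRisk

/-! Let `μ_y` be the law of the feature vector on the event that the label is `y`. An adversary can
spoil label 0 exactly where it can reach `A`, and label 1 exactly where it can reach `Aᶜ`, so the
risk should be `μ₀ (reach ε A) + μ₁ (reach ε Aᶜ)` (`robustRisk_eq`). Measurable attacks are easy to
build on open thickenings only; this loses nothing because, for `ε > 0`, the points at distance
exactly `ε` from a set are Lebesgue null and `μ_y ≪ vol`. The same null set turns the reachable sets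
into the offsets `A^ε` and the complement of `A^{-ε}`. The risk is then `w₁` minus the functional to
be maximized, which gives the equivalence.

The infimum formula is a Strassen-type duality. Weak direction: the midpoint of two points at
distance at most `2ε` is within `ε` of both, and it lies in `A` or in `Aᶜ`; hence every zero-cost
pair is charged to a reachable set (`one_sub_integral_cost_le`). Strong direction: for every `η > 0`
there are a set `A` and a partial coupling `γ` of `μ₀` and `μ₁` on pairs at distance at most `2ε`
whose mass is at least the risk of `A` minus `η` (`exists_partial_coupling`). For `ε > 0` it comes
from cutting the space into small cells and applying a weighted König theorem; the error in
distances caused by the cells is absorbed by a dilation with ratio slightly above 1, which hardly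
changes absolutely continuous measures. For `ε = 0` a Hahn decomposition suffices. Two copies of
`γ`, one per label, extend to a coupling of `ν` and `ν^S`. -/

namespace AdvRisk

open Metric Filter Topology
open scoped Pointwise

/-! ### Points at distance exactly `ε` from a set. -/

section Geometry

variable {E : Type*} [NormedAddCommGroup E] [NormedSpace ℝ E] [FiniteDimensional ℝ E]
  [MeasurableSpace E] [BorelSpace E]

/-- Lebesgue density: a point `x` of this set has a nearest point `a` in the closure of `A`, at
distance exactly `ε`, and the open ball about `a` of radius `ε` misses the set. Small balls moved
from `x` towards `a` lie in that ball, so `x` is not a density point. -/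
theorem addHaar_cthickening_diff_thickening (vol : Measure E) [vol.IsAddHaarMeasure]
    (A : Set E) {ε : ℝ} (hε : 0 < ε) :
    vol (cthickening ε A \ thickening ε A) = 0 := by
  set S := cthickening ε A \ thickening ε A with hS
  have hmeas : MeasurableSet S :=
    isClosed_cthickening.measurableSet.diff isOpen_thickening.measurableSet
  -- The constant 2 allows balls of radius `δ` centred up to `2δ` away from `x`. Centred `2δ`
  -- towards `a`, such a ball stays within `ε - δ` of `a`.
  have key := IsUnifLocDoublingMeasure.ae_tendsto_measure_inter_div vol S 2
  rw [ae_restrict_iff' hmeas] at key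
  rw [measure_eq_zero_iff_ae_notMem]
  filter_upwards [key] with x key hx
  have hx' := @key hx ℝ (𝓝[>] 0)
  have hx1 := hx.1
  rw [← cthickening_closure, isClosed_closure.cthickening_eq_biUnion_closedBall hε.le] at hx1
  obtain ⟨a, ha, hxa⟩ := mem_iUnion₂.1 hx1
  have hball : ball a ε ⊆ thickening ε A := by
    rw [← thickening_closure]
    intro y hy
    exact mem_thickening_iff.2 ⟨a, ha, hy⟩
  have hxa' : dist x a = ε := by
    refine le_antisymm hxa ?_
    by_contra h
    exact hx.2 (hball (by simpa using h))
  have hd (δ : ℝ) (hδ : 0 ≤ δ) : dist x (x + (2 * δ / ε) • (a - x)) = 2 * δ := by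
    rw [dist_self_add_right, norm_smul, ← dist_eq_norm, dist_comm, hxa', Real.norm_eq_abs,
      abs_of_nonneg (by positivity)]
    field_simp
  have h1 := hx' (fun δ : ℝ => x + (2 * δ / ε) • (a - x)) (fun δ => δ) tendsto_id (by
    filter_upwards [self_mem_nhdsWithin] with δ hδ
    rw [mem_closedBall, hd δ (le_of_lt hδ)])
  refine zero_ne_one (tendsto_nhds_unique (tendsto_const_nhds.congr' ?_) h1)
  have hsmall : ∀ᶠ δ : ℝ in 𝓝[>] 0, δ < ε / 2 :=
    nhdsWithin_le_nhds (eventually_lt_nhds (by positivity))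
  filter_upwards [self_mem_nhdsWithin, hsmall] with δ hδ hδ2
  have hδ0 : 0 < δ := hδ
  have hda : dist (x + (2 * δ / ε) • (a - x)) a = ε - 2 * δ := by
    have : x + (2 * δ / ε) • (a - x) - a = (1 - 2 * δ / ε) • (x - a) := by module
    have h2 : 2 * δ / ε ≤ 1 := by rw [div_le_one hε]; linarith
    rw [dist_eq_norm, this, norm_smul, ← dist_eq_norm x a, hxa', Real.norm_eq_abs,
      abs_of_nonneg (by linarith)]
    field_simp
  have hempty : S ∩ closedBall (x + (2 * δ / ε) • (a - x)) δ = ∅ := by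
    rw [← disjoint_iff_inter_eq_empty]
    refine disjoint_left.2 fun y hy hy' => hy.2 (hball ?_)
    rw [mem_closedBall] at hy'
    rw [mem_ball]
    linarith [dist_triangle y (x + (2 * δ / ε) • (a - x)) a]
  simp [hempty]

end Geometry

/-- The points from which an adversary of power `ε` can reach `A`. -/
def reach {E : Type*} [PseudoMetricSpace E] (ε : ℝ) (A : Set E) : Set E :=
  {x | ∃ m ∈ A, dist m x ≤ ε}

/-- The law of the feature vector on the event that the label is `y`. -/
noncomputable def labelMeasure {E : Type*} [MeasurableSpace E] (ν : Measure (E × Fin 2))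
    (y : Fin 2) : Measure E :=
  (ν.restrict (Prod.snd ⁻¹' {y})).map Prod.fst

/-! ### Reachable sets and measurable attacks. -/

section Reach

variable {E : Type*} [PseudoMetricSpace E] {ε : ℝ} {A : Set E}

theorem thickening_subset_reach : thickening ε A ⊆ reach ε A := fun x hx => by
  obtain ⟨m, hm, h⟩ := mem_thickening_iff.1 hx
  exact ⟨m, hm, by rw [dist_comm]; exact h.le⟩

theorem reach_subset_cthickening : reach ε A ⊆ cthickening ε A := fun x ⟨m, hm, h⟩ =>
  mem_cthickening_of_dist_le x m ε A hm (by rwa [dist_comm])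

theorem subset_reach (hε : 0 ≤ ε) : A ⊆ reach ε A := fun x hx => ⟨x, hx, by simpa⟩

/-- Stay put in `A` or outside the thickening; otherwise move to the first term of a dense sequence
of `A` at distance less than `ε`. The strict inequality is what lets a countable dense set suffice.
-/
theorem exists_measurable_selection [SecondCountableTopology E] [MeasurableSpace E]
    [BorelSpace E] (hA : MeasurableSet A) (hε : 0 ≤ ε) :
    ∃ h : E → E, Measurable h ∧ (∀ x, dist (h x) x ≤ ε) ∧
      ∀ x ∈ A ∪ thickening ε A, h x ∈ A := by
  classical
  rcases A.eq_empty_or_nonempty with rfl | hne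
  · exact ⟨id, measurable_id, fun _ => by simpa, by simp⟩
  have : Nonempty A := hne.to_subtype
  let u := TopologicalSpace.denseSeq A
  let f : ℕ → E → E := fun n x => match n with
    | 0 => x
    | k + 1 => u k
  let p : ℕ → E → Prop := fun n x => match n with
    | 0 => x ∈ A ∨ x ∉ thickening ε A
    | k + 1 => dist (u k : E) x < ε
  have hex : ∀ x, ∃ n, p n x := by
    intro x
    by_cases hx : x ∈ A ∨ x ∉ thickening ε A
    · exact ⟨0, hx⟩
    · push Not at hx
      obtain ⟨m, hm, h⟩ := mem_thickening_iff.1 hx.2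
      obtain ⟨k, hk⟩ := (TopologicalSpace.denseRange_denseSeq A).exists_dist_lt ⟨m, hm⟩
        (sub_pos.2 h)
      refine ⟨k + 1, ?_⟩
      change dist (u k : E) x < ε
      rw [Subtype.dist_eq, dist_comm] at hk
      rw [dist_comm x m] at hk h
      have := dist_triangle (u k : E) m x
      change dist (u k : E) m < _ at hk
      linarith
  have hf : ∀ n, Measurable (f n) := by
    rintro (_ | k)
    · exact measurable_id
    · exact measurable_const
  have hp : ∀ n, MeasurableSet {x | p n x} := by
    rintro (_ | k)
    · exact hA.union isOpen_thickening.measurableSet.compl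
    · exact (isOpen_lt (continuous_const.dist continuous_id) continuous_const).measurableSet
  have hdec : ∀ x, DecidablePred fun n => p n x := fun x n => Classical.dec _
  obtain ⟨h, hm, hspec⟩ : ∃ h : E → E, Measurable h ∧ ∀ x, ∃ n, p n x ∧ h x = f n x :=
    ⟨_, Measurable.find hf hp hex, fun x => ⟨_, Nat.find_spec (hex x), rfl⟩⟩
  refine ⟨h, hm, fun x => ?_, fun x hx => ?_⟩ <;> obtain ⟨_ | k, hpx, hfx⟩ := hspec x <;> rw [hfx]
  · simpa [f]
  · exact le_of_lt hpx
  · have h' : x ∈ A ∨ x ∉ thickening ε A := hpx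
    change x ∈ A
    rcases hx with hx | hx <;> tauto
  · exact (u k).2

end Reach

/-- The union with `A` matters only for `ε = 0`, where the thickening is empty. -/
theorem reach_ae_eq {E : Type*} [NormedAddCommGroup E] [NormedSpace ℝ E]
    [FiniteDimensional ℝ E] [MeasurableSpace E] [BorelSpace E]
    {vol : Measure E} [vol.IsAddHaarMeasure] {μ : Measure E} (hμ : μ ≪ vol) {ε : ℝ} (hε : 0 ≤ ε)
    (A : Set E) : (A ∪ thickening ε A : Set E) =ᵐ[μ] reach ε A := by
  refine (union_subset (subset_reach hε) thickening_subset_reach).eventuallyLE.antisymm ?_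
  rcases hε.eq_or_lt with rfl | hε'
  · refine LE.le.eventuallyLE fun x hx => ?_
    obtain ⟨m, hm, h⟩ := hx
    rw [dist_le_zero] at h
    exact Or.inl (h ▸ hm)
  · rw [ae_le_set]
    refine hμ (measure_mono_null ?_ (addHaar_cthickening_diff_thickening vol A hε'))
    exact fun x hx => ⟨reach_subset_cthickening hx.1, fun h => hx.2 (Or.inr h)⟩

/-! ### Splitting by label, and closed forms of the risk. -/

section LabelMeasure

variable {E : Type*} [MeasurableSpace E]

instance (ν : Measure (E × Fin 2)) [IsFiniteMeasure ν] (y : Fin 2) :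
    IsFiniteMeasure (labelMeasure ν y) := by
  unfold labelMeasure; infer_instance

theorem labelMeasure_apply (ν : Measure (E × Fin 2)) (y : Fin 2) {B : Set E}
    (hB : MeasurableSet B) : labelMeasure ν y B = ν (B ×ˢ {y}) := by
  rw [labelMeasure, Measure.map_apply measurable_fst hB,
    Measure.restrict_apply (measurable_fst hB)]
  rfl

theorem measure_eq_labelMeasure_add (ν : Measure (E × Fin 2)) {L : Set (E × Fin 2)}
    (hL : MeasurableSet L) :
    ν L = labelMeasure ν 0 {x | (x, 0) ∈ L} + labelMeasure ν 1 {x | (x, 1) ∈ L} := by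
  have h (y : Fin 2) : MeasurableSet {x : E | (x, y) ∈ L} :=
    measurable_prodMk_right hL
  rw [labelMeasure_apply _ _ (h 0), labelMeasure_apply _ _ (h 1), ← measure_union]
  · congr 1
    ext ⟨x, y⟩
    fin_cases y <;> simp
  · rw [disjoint_left]
    rintro ⟨x, y⟩ h1 h2
    simp only [mem_prod, mem_singleton_iff] at h1 h2
    exact absurd (h1.2.symm.trans h2.2) (by decide)
  · exact (h 1).prod (measurableSet_singleton _)

theorem labelMeasure_univ (ν : Measure (E × Fin 2)) (y : Fin 2) :
    (labelMeasure ν y).real univ = labelWeight ν y := by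
  rw [measureReal_def, labelMeasure_apply _ _ MeasurableSet.univ, labelWeight, measureReal_def,
    univ_prod]

theorem IsCondDensity.labelMeasure_eq {vol : Measure E} {ν : Measure (E × Fin 2)}
    [IsFiniteMeasure ν] {y : Fin 2} {ρ : E → ℝ} (h : IsCondDensity vol ν y ρ) :
    labelMeasure ν y
      = ν (Prod.snd ⁻¹' {y}) • vol.withDensity (fun x => ENNReal.ofReal (ρ x)) := by
  by_cases h0 : ν (Prod.snd ⁻¹' {y}) = 0
  · rw [h0, zero_smul, labelMeasure, Measure.restrict_eq_zero.2 h0, Measure.map_zero]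
  · rw [← h.condLaw h0, ProbabilityTheory.cond, Measure.map_smul, smul_smul,
      ENNReal.mul_inv_cancel h0 (measure_ne_top _ _), one_smul, labelMeasure]

theorem IsCondDensity.absolutelyContinuous {vol : Measure E} {ν : Measure (E × Fin 2)}
    [IsFiniteMeasure ν] {y : Fin 2} {ρ : E → ℝ} (h : IsCondDensity vol ν y ρ) :
    labelMeasure ν y ≪ vol := by
  rw [h.labelMeasure_eq]
  exact (Measure.AbsolutelyContinuous.refl _).smul_left _ |>.trans
    (withDensity_absolutelyContinuous _ _)

theorem IsCondDensity.labelMeasure_real {vol : Measure E} {ν : Measure (E × Fin 2)}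
    [IsFiniteMeasure ν] {y : Fin 2} {ρ : E → ℝ} (h : IsCondDensity vol ν y ρ) {B : Set E}
    (hB : MeasurableSet B) :
    (labelMeasure ν y).real B = labelWeight ν y * ∫ x in B, ρ x ∂vol := by
  rw [h.labelMeasure_eq, measureReal_def, Measure.smul_apply, smul_eq_mul, ENNReal.toReal_mul,
    withDensity_apply _ hB, labelWeight, measureReal_def,
    integral_eq_lintegral_of_nonneg_ae (ae_of_all _ h.nonneg)
      h.measurable.aestronglyMeasurable]

theorem integral_zeroOneLoss (ν : Measure (E × Fin 2)) [IsFiniteMeasure ν] {A : Set E}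
    (hA : MeasurableSet A) {g : E × Fin 2 → E} (hg : Measurable g) :
    ∫ z, zeroOneLoss (classifier A (g z)) z.2 ∂ν
      = (labelMeasure ν 0).real {x | g (x, 0) ∈ A}
        + (labelMeasure ν 1).real {x | g (x, 1) ∈ Aᶜ} := by
  let L : Set (E × Fin 2) := {z | g z ∈ A ∧ z.2 = 0} ∪ {z | g z ∈ Aᶜ ∧ z.2 = 1}
  have hL : MeasurableSet L :=
    ((hg hA).inter (measurable_snd (measurableSet_singleton 0))).union
      ((hg hA.compl).inter (measurable_snd (measurableSet_singleton 1)))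
  have hfun : (fun z => zeroOneLoss (classifier A (g z)) z.2) = L.indicator 1 := by
    classical
    ext ⟨x, y⟩
    by_cases h : g (x, y) ∈ A <;> fin_cases y <;> simp_all [zeroOneLoss, classifier, L, indicator]
  rw [hfun, integral_indicator_one hL, measureReal_def, measure_eq_labelMeasure_add ν hL,
    ENNReal.toReal_add (measure_ne_top _ _) (measure_ne_top _ _)]
  simp [L, measureReal_def]

end LabelMeasure

/-- Any attack errs only inside the reachable sets. Conversely, the attack that uses the selection
for `A` on label 0 and the one for `Aᶜ` on label 1 errs almost everywhere on them, so the supremum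
is attained. -/
theorem robustRisk_eq {E : Type*} [NormedAddCommGroup E] [NormedSpace ℝ E]
    [FiniteDimensional ℝ E] [MeasurableSpace E] [BorelSpace E]
    {vol : Measure E} [vol.IsAddHaarMeasure] {ν : Measure (E × Fin 2)} [IsFiniteMeasure ν]
    (hν : ∀ y, labelMeasure ν y ≪ vol) {ε : ℝ} (hε : 0 ≤ ε) {A : Set E} (hA : MeasurableSet A) :
    robustRisk ν ε (classifier A)
      = (labelMeasure ν 0).real (reach ε A) + (labelMeasure ν 1).real (reach ε Aᶜ) := by
  have hle (g : Attacks E ε) : ∫ z, zeroOneLoss (classifier A (g.1 z)) z.2 ∂ν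
      ≤ (labelMeasure ν 0).real (reach ε A) + (labelMeasure ν 1).real (reach ε Aᶜ) := by
    rw [integral_zeroOneLoss ν hA g.2.1]
    exact add_le_add (measureReal_mono fun x hx => ⟨_, hx, g.2.2 _⟩)
      (measureReal_mono fun x hx => ⟨_, hx, g.2.2 _⟩)
  have : Nonempty (Attacks E ε) := ⟨⟨Prod.fst, measurable_fst, fun _ => by simpa⟩⟩
  refine le_antisymm (ciSup_le hle) ?_
  obtain ⟨h₀, hm₀, hd₀, hs₀⟩ := exists_measurable_selection hA hε
  obtain ⟨h₁, hm₁, hd₁, hs₁⟩ := exists_measurable_selection hA.compl hε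
  let g : E × Fin 2 → E := fun z => if z.2 = 0 then h₀ z.1 else h₁ z.1
  have hg : Measurable g :=
    Measurable.ite (measurable_snd (measurableSet_singleton 0)) (hm₀.comp measurable_fst)
      (hm₁.comp measurable_fst)
  have hgd : ∀ z, dist (g z) z.1 ≤ ε := fun z => by
    by_cases h : z.2 = 0 <;> simp [g, h, hd₀, hd₁]
  refine le_ciSup_of_le ⟨_, forall_mem_range.2 hle⟩ ⟨g, hg, hgd⟩ ?_
  rw [integral_zeroOneLoss ν hA hg, measureReal_def, measureReal_def,
    ← measure_congr (reach_ae_eq (hν 0) hε A), ← measure_congr (reach_ae_eq (hν 1) hε Aᶜ)]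
  exact add_le_add (measureReal_mono fun x hx => by simpa [g] using hs₀ x hx)
      (measureReal_mono fun x hx => by simpa [g] using hs₁ x hx)

theorem offset_eq_cthickening {E : Type*} [PseudoMetricSpace E] {ε : ℝ} (hε : 0 < ε) (B : Set E) :
    offset B ε = cthickening ε B := by
  ext x
  simp only [offset, signedDistTo, mem_ofPred_eq, cthickening]
  have he : (ε : EReal) = ((ENNReal.ofReal ε : ℝ≥0∞) : EReal) := by
    rw [EReal.coe_ennreal_ofReal, max_eq_left hε.le]
  split_ifs with h
  · simp only [infEDist_zero_of_mem h, zero_le, iff_true]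
    refine le_trans ?_ (EReal.coe_nonneg.2 hε.le)
    rw [EReal.neg_le, neg_zero]
    exact EReal.coe_ennreal_nonneg _
  · rw [he, EReal.coe_ennreal_le_coe_ennreal_iff]

theorem offset_neg_eq_compl_thickening {E : Type*} [PseudoMetricSpace E] {ε : ℝ} (hε : 0 < ε)
    (B : Set E) : offset B (-ε) = (thickening ε Bᶜ)ᶜ := by
  ext x
  have he : (ε : EReal) = ((ENNReal.ofReal ε : ℝ≥0∞) : EReal) := by
    rw [EReal.coe_ennreal_ofReal, max_eq_left hε.le]
  simp only [offset, signedDistTo, mem_ofPred_eq, thickening, mem_compl_iff, not_lt]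
  split_ifs with h
  · rw [EReal.coe_neg, EReal.neg_le_neg_iff, he, EReal.coe_ennreal_le_coe_ennreal_iff]
  · rw [infEDist_zero_of_mem (show x ∈ Bᶜ from h)]
    constructor
    · intro h'
      have := (EReal.coe_ennreal_nonneg _).trans h'
      rw [EReal.coe_nonneg] at this
      linarith
    · intro h'
      simp at h'
      linarith

theorem robustRisk_eq_sub {E : Type*} [NormedAddCommGroup E] [NormedSpace ℝ E]
    [FiniteDimensional ℝ E] [MeasurableSpace E] [BorelSpace E]
    {vol : Measure E} [vol.IsAddHaarMeasure] {ν : Measure (E × Fin 2)} [IsFiniteMeasure ν]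
    {ρ₀ ρ₁ : E → ℝ} (hρ₀ : IsCondDensity vol ν 0 ρ₀) (hρ₁ : IsCondDensity vol ν 1 ρ₁)
    {ε : ℝ} (hε : 0 < ε) {B : Set E} (hB : MeasurableSet B) :
    robustRisk ν ε (classifier B) = labelWeight ν 1 -
      (labelWeight ν 1 * ∫ x in offset B (-ε), ρ₁ x ∂vol
        - labelWeight ν 0 * ∫ x in offset B ε, ρ₀ x ∂vol) := by
  have hν : ∀ y, labelMeasure ν y ≪ vol := by
    intro y
    fin_cases y
    exacts [hρ₀.absolutelyContinuous, hρ₁.absolutelyContinuous]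
  have hct (y : Fin 2) (A : Set E) :
      thickening ε A =ᵐ[labelMeasure ν y] cthickening ε A :=
    (thickening_subset_cthickening ε A).eventuallyLE.antisymm <|
      ae_le_set.2 (hν y (addHaar_cthickening_diff_thickening vol A hε))
  have h₀ : (labelMeasure ν 0).real (reach ε B) = (labelMeasure ν 0).real (offset B ε) := by
    rw [offset_eq_cthickening hε]
    refine le_antisymm (measureReal_mono reach_subset_cthickening) ?_
    rw [← measureReal_congr (hct 0 B)]
    exact measureReal_mono thickening_subset_reach
  have h₁ : (labelMeasure ν 1).real (reach ε Bᶜ)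
      = labelWeight ν 1 - (labelMeasure ν 1).real (offset B (-ε)) := by
    rw [offset_neg_eq_compl_thickening hε, measureReal_compl isOpen_thickening.measurableSet,
      labelMeasure_univ, sub_sub_cancel]
    refine le_antisymm ?_ (measureReal_mono thickening_subset_reach)
    rw [measureReal_congr (hct 1 Bᶜ)]
    exact measureReal_mono reach_subset_cthickening
  have hm₀ : MeasurableSet (offset B ε) := by
    rw [offset_eq_cthickening hε]
    exact isClosed_cthickening.measurableSet
  have hm₁ : MeasurableSet (offset B (-ε)) := by
    rw [offset_neg_eq_compl_thickening hε]
    exact isOpen_thickening.measurableSet.compl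
  rw [robustRisk_eq hν hε.le hB, h₀, h₁, hρ₀.labelMeasure_real hm₀, hρ₁.labelMeasure_real hm₁]
  ring

/-! ### Finite duality between matchings and covers. -/

section Matching

variable {I J : Type*} [Fintype I] [Fintype J]

/-- Weighted partial matchings along the relation `r` with capacities `a` and `b`. -/
def matchings (a : I → ℝ) (b : J → ℝ) (r : I → J → Prop) : Set (I → J → ℝ) :=
  {p | (∀ i j, 0 ≤ p i j) ∧ (∀ i j, ¬ r i j → p i j = 0) ∧ (∀ i, ∑ j, p i j ≤ a i) ∧
    ∀ j, ∑ i, p i j ≤ b j}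

theorem isCompact_matchings (a : I → ℝ) (b : J → ℝ) (r : I → J → Prop) :
    IsCompact (matchings a b r) := by
  refine (isCompact_Icc (a := (0 : I → J → ℝ)) (b := fun i _ => a i)).of_isClosed_subset ?_ ?_
  · have hc (i : I) (j : J) : Continuous fun p : I → J → ℝ => p i j := by fun_prop
    simp only [matchings, ofPred_and, ofPred_forall]
    refine IsClosed.inter ?_ (IsClosed.inter ?_ (IsClosed.inter ?_ ?_))
    · exact isClosed_iInter fun i => isClosed_iInter fun j =>
        isClosed_le continuous_const (hc i j)
    · exact isClosed_iInter fun i => isClosed_iInter fun j => isClosed_iInter fun _ =>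
        isClosed_eq (hc i j) continuous_const
    · exact isClosed_iInter fun i => isClosed_le (by fun_prop) continuous_const
    · exact isClosed_iInter fun j => isClosed_le (by fun_prop) continuous_const
  · intro p hp
    refine ⟨fun i j => hp.1 i j, fun i j => le_trans ?_ (hp.2.2.1 i)⟩
    exact Finset.single_le_sum (f := fun j => p i j) (fun j _ => hp.1 i j) (Finset.mem_univ j)

/-- Weighted König theorem: some matching is as large as some vertex cover. -/
theorem exists_matching_ge_cover {a : I → ℝ} {b : J → ℝ} (ha : ∀ i, 0 ≤ a i) (hb : ∀ j, 0 ≤ b j)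
    (r : I → J → Prop) :
    ∃ p ∈ matchings a b r, ∃ S : Set I, ∃ (s : Finset I) (t : Finset J),
      (∀ i, i ∈ s ↔ i ∉ S) ∧ (∀ j, j ∈ t ↔ ∃ i ∈ S, r i j) ∧
      ∑ i ∈ s, a i + ∑ j ∈ t, b j ≤ ∑ i, ∑ j, p i j := by
  classical
  obtain ⟨p₀, hp₀, hmax₀⟩ := (isCompact_matchings a b r).exists_isMaxOn
    ⟨0, by simp [matchings, ha, hb]⟩
    (f := fun p => ∑ i, ∑ j, p i j) (by fun_prop)
  let M : Set (I → J → ℝ) := {p | p ∈ matchings a b r ∧ ∀ q ∈ matchings a b r,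
    ∑ i, ∑ j, q i j ≤ ∑ i, ∑ j, p i j}
  let slack : (I → J → ℝ) → Finset I := fun p => Finset.univ.filter fun i => ∑ j, p i j < a i
  -- Among the matchings of maximal mass, take one with the most unsaturated rows. This second
  -- extremality replaces the search for augmenting paths.
  obtain ⟨p, ⟨hp, hmax⟩, hcard⟩ : sSup ((fun p => (slack p).card) '' M) ∈
      (fun p => (slack p).card) '' M :=
    Nat.sSup_mem ⟨_, p₀, ⟨hp₀, fun q hq => hmax₀ hq⟩, rfl⟩
      ⟨Fintype.card I, forall_mem_image.2 fun q _ => Finset.card_le_univ _⟩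
  have hcard' : ∀ q ∈ M, (slack q).card ≤ (slack p).card := fun q hq => by
    simp only at hcard
    rw [hcard]
    exact le_csSup ⟨Fintype.card I, forall_mem_image.2 fun q _ => Finset.card_le_univ _⟩
      ⟨q, hq, rfl⟩
  let e : I → J → ℝ → I → J → ℝ := fun i j t i₀ j₀ => if i₀ = i then if j₀ = j then t else 0 else 0
  have erow (i j t i₀) : ∑ j₀, e i j t i₀ j₀ = if i₀ = i then t else 0 := by
    by_cases h : i₀ = i <;> simp [e, h]
  have ecol (i j t j₀) : ∑ i₀, e i j t i₀ j₀ = if j₀ = j then t else 0 := by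
    simp [e]
  have etot (i j t) : ∑ i₀, ∑ j₀, e i j t i₀ j₀ = t := by
    simp [erow]
  obtain ⟨hp0, hpr, hpa, hpb⟩ := hp
  -- If a column adjacent to an unsaturated row had room left, mass could be added there.
  have hsat : ∀ i ∈ slack p, ∀ j, r i j → ∑ i, p i j = b j := by
    intro i hi j hij
    have hi' : ∑ j, p i j < a i := by simpa [slack] using hi
    by_contra hne
    have hj' : ∑ i, p i j < b j := lt_of_le_of_ne (hpb j) hne
    set t := min (a i - ∑ j, p i j) (b j - ∑ i, p i j)
    have ht : 0 < t := lt_min (by linarith) (by linarith)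
    have ht1 : t ≤ a i - ∑ j, p i j := min_le_left _ _
    have ht2 : t ≤ b j - ∑ i, p i j := min_le_right _ _
    have := hmax (p + e i j t) ⟨fun i₀ j₀ => ?_, fun i₀ j₀ h => ?_, fun i₀ => ?_, fun j₀ => ?_⟩
    · simp only [Pi.add_apply, Finset.sum_add_distrib, etot] at this
      linarith
    · have : 0 ≤ e i j t i₀ j₀ := by
        simp only [e]; split_ifs <;> linarith
      exact add_nonneg (hp0 i₀ j₀) this
    · have : e i j t i₀ j₀ = 0 := by
        simp only [e]
        split_ifs with h1 h2
        · subst h1 h2; exact absurd hij h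
        all_goals rfl
      simp [this, hpr i₀ j₀ h]
    · simp only [Pi.add_apply, Finset.sum_add_distrib, erow]
      split_ifs with h
      · subst h; linarith
      · simpa using hpa i₀
    · simp only [Pi.add_apply, Finset.sum_add_distrib, ecol]
      split_ifs with h
      · subst h; linarith
      · simpa using hpb j₀
  -- Otherwise, moving mass in column `j` from row `i'` to row `i` keeps the total and makes `i'`
  -- unsaturated as well.
  have hzero : ∀ i ∈ slack p, ∀ j, r i j → ∀ i' ∉ slack p, p i' j = 0 := by
    intro i hi j hij i' hi'
    have hi1 : ∑ j, p i j < a i := by simpa [slack] using hi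
    have hne : i ≠ i' := fun h => hi' (h ▸ hi)
    by_contra hpos
    replace hpos : 0 < p i' j := lt_of_le_of_ne (hp0 i' j) (Ne.symm hpos)
    have hr' : r i' j := by
      by_contra h
      exact hpos.ne' (hpr _ _ h)
    -- Only half of the room is used, so that row `i` stays unsaturated.
    set t := min ((a i - ∑ j, p i j) / 2) (p i' j)
    have ht : 0 < t := lt_min (by linarith) hpos
    have ht1 : t ≤ (a i - ∑ j, p i j) / 2 := min_le_left _ _
    have ht2 : t ≤ p i' j := min_le_right _ _
    have hrow (i₀) : ∑ j₀, (p + e i j t - e i' j t) i₀ j₀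
        = ∑ j, p i₀ j + (if i₀ = i then t else 0) - (if i₀ = i' then t else 0) := by
      simp only [Pi.add_apply, Pi.sub_apply, Finset.sum_add_distrib, Finset.sum_sub_distrib, erow]
    have hq : p + e i j t - e i' j t ∈ M := by
      refine ⟨⟨fun i₀ j₀ => ?_, fun i₀ j₀ h => ?_, fun i₀ => ?_, fun j₀ => ?_⟩, fun q hq => ?_⟩
      · have := hp0 i₀ j₀
        simp only [Pi.add_apply, Pi.sub_apply, e]
        split_ifs with h1 h2 h3 h3 <;> subst_vars <;> linarith
      · have h1 : e i j t i₀ j₀ = 0 := by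
          simp only [e]
          split_ifs with h1 h2
          · subst h1 h2; exact absurd hij h
          all_goals rfl
        have h2 : e i' j t i₀ j₀ = 0 := by
          simp only [e]
          split_ifs with h1 h2
          · subst h1 h2; exact absurd hr' h
          all_goals rfl
        simp [h1, h2, hpr i₀ j₀ h]
      · rw [hrow]
        have := hpa i₀
        split_ifs with h1 h2 <;> subst_vars <;> linarith
      · simp only [Pi.add_apply, Pi.sub_apply, Finset.sum_add_distrib, Finset.sum_sub_distrib, ecol]
        have := hpb j₀
        linarith
      · refine (hmax q hq).trans_eq ?_
        simp only [Pi.add_apply, Pi.sub_apply, Finset.sum_add_distrib, Finset.sum_sub_distrib, etot]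
        ring
    refine absurd (hcard' _ hq) (not_le.2 (Finset.card_lt_card ?_))
    refine (Finset.ssubset_iff_of_subset fun i₀ h₀ => ?_).2 ⟨i', ?_, hi'⟩
    · have h₀' : ∑ j, p i₀ j < a i₀ := by simpa [slack] using h₀
      simp only [slack, Finset.mem_filter_univ, hrow]
      split_ifs with h1 h2 <;> subst_vars <;> linarith
    · have := hpa i'
      simp only [slack, Finset.mem_filter_univ, hrow, if_neg hne.symm, if_true]
      linarith
  let t : Finset J := Finset.univ.filter fun j => ∃ i ∈ slack p, r i j
  refine ⟨p, ⟨hp0, hpr, hpa, hpb⟩, slack p, (slack p)ᶜ, t, by simp, by simp [t], ?_⟩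
  rw [← Finset.sum_compl_add_sum (slack p)]
  refine add_le_add (Finset.sum_le_sum fun i hi => ?_) ?_
  · simpa [slack] using hi
  · calc ∑ j ∈ t, b j = ∑ j ∈ t, ∑ i, p i j := Finset.sum_congr rfl fun j hj => by
          obtain ⟨i, hi, hij⟩ := (Finset.mem_filter.1 hj).2
          rw [hsat i hi j hij]
      _ = ∑ j ∈ t, ∑ i ∈ slack p, p i j := Finset.sum_congr rfl fun j hj => by
          obtain ⟨i, hi, hij⟩ := (Finset.mem_filter.1 hj).2
          rw [← Finset.sum_subset (Finset.subset_univ (slack p))]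
          exact fun i' _ h' => hzero i hi j hij i' h'
      _ = ∑ i ∈ slack p, ∑ j ∈ t, p i j := Finset.sum_comm
      _ ≤ ∑ i ∈ slack p, ∑ j, p i j := Finset.sum_le_sum fun i _ =>
          Finset.sum_le_sum_of_subset_of_nonneg (Finset.subset_univ _) fun j _ _ => hp0 i j

end Matching

/-! ### Dilations close to the identity. -/

section Dilation

variable {E : Type*} [NormedAddCommGroup E] [NormedSpace ℝ E] [FiniteDimensional ℝ E]
  [MeasurableSpace E] [BorelSpace E]

theorem tendsto_integral_norm_dilation_sub (vol : Measure E) [vol.IsAddHaarMeasure] {g : E → ℝ}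
    (hg : Continuous g) (hgs : HasCompactSupport g) (d : ℕ) :
    Tendsto (fun c : ℝ => ∫ x, ‖c ^ d * g (c • x) - g x‖ ∂vol) (𝓝 1) (𝓝 0) := by
  obtain ⟨M, hM⟩ := hgs.exists_bound_of_continuous hg
  obtain ⟨R, hR⟩ := hgs.isCompact.isBounded.subset_closedBall (0 : E)
  have hg0 : ∀ x, R < ‖x‖ → g x = 0 := fun x hx => by
    by_contra h
    have := hR (subset_tsupport g h)
    rw [mem_closedBall_zero_iff] at this
    linarith
  have h0 : ∫ x, ‖(1 : ℝ) ^ d * g ((1 : ℝ) • x) - g x‖ ∂vol = 0 := by simp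
  rw [← h0]
  -- For `1/2 < c < 2`, both `g` and its dilate vanish outside the ball of radius `2R`, and `c ^ d ≤
  -- 2 ^ d`.
  refine tendsto_integral_filter_of_dominated_convergence
    ((closedBall (0 : E) (2 * R)).indicator fun _ => 2 ^ d * M + M) ?_ ?_ ?_ ?_
  · exact Eventually.of_forall fun c => by fun_prop
  · have h1 : ∀ᶠ c : ℝ in 𝓝 1, 1 / 2 < c := eventually_gt_nhds (by norm_num)
    have h2 : ∀ᶠ c : ℝ in 𝓝 1, c < 2 := eventually_lt_nhds (by norm_num)
    filter_upwards [h1, h2] with c hc1 hc2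
    refine ae_of_all _ fun x => ?_
    by_cases hx : x ∈ closedBall (0 : E) (2 * R)
    · rw [indicator_of_mem hx, norm_norm]
      refine (norm_sub_le _ _).trans (add_le_add ?_ (hM x))
      rw [norm_mul, norm_pow, Real.norm_of_nonneg (by linarith)]
      gcongr
      exact hM _
    · rw [indicator_of_notMem hx]
      rw [mem_closedBall_zero_iff, not_le] at hx
      have hx0 := norm_nonneg x
      rw [hg0 x (by linarith), hg0 (c • x)]
      · simp
      · rw [norm_smul, Real.norm_of_nonneg (by linarith)]
        nlinarith
  · exact (integrable_indicator_iff measurableSet_closedBall).2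
      (integrableOn_const measure_closedBall_lt_top.ne)
  · refine ae_of_all _ fun x => ?_
    have : Continuous fun c : ℝ => ‖c ^ d * g (c • x) - g x‖ := by fun_prop
    exact this.tendsto 1

/-- The density is approximated in `L¹` by a continuous compactly supported `g`, for which dilation
is `L¹`-continuous. All the errors are `L¹` norms, hence uniform in `B`; this allows `c` to be fixed
before the set is known. -/
theorem eventually_measureReal_smul_le {vol μ : Measure E} [vol.IsAddHaarMeasure]
    [IsFiniteMeasure μ] (hμ : μ ≪ vol) {η : ℝ} (hη : 0 < η) :
    ∀ᶠ c : ℝ in 𝓝 1, ∀ B : Set E, MeasurableSet B → μ.real (c • B) ≤ μ.real B + η := by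
  set ρ : E → ℝ := fun x => (μ.rnDeriv vol x).toReal
  have hρ : Integrable ρ vol := Measure.integrable_toReal_rnDeriv
  have hint (B : Set E) : ∫ x in B, ρ x ∂vol = μ.real B := Measure.setIntegral_toReal_rnDeriv hμ B
  obtain ⟨g, hgs, hgρ, hgc, hgi⟩ := hρ.exists_hasCompactSupport_integral_sub_le
    (show 0 < η / 4 by positivity)
  have happrox (B : Set E) : |μ.real B - ∫ x in B, g x ∂vol| ≤ η / 4 := by
    rw [← hint, ← integral_sub hρ.integrableOn hgi.integrableOn]
    rw [← Real.norm_eq_abs]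
    refine (norm_integral_le_integral_norm _).trans (le_trans ?_ hgρ)
    exact setIntegral_le_integral (hρ.sub hgi).norm (ae_of_all _ fun _ => norm_nonneg _)
  have hlim := tendsto_integral_norm_dilation_sub vol hgc hgs (Module.finrank ℝ E)
  have hpos : ∀ᶠ c : ℝ in 𝓝 1, 0 < c := eventually_gt_nhds (by norm_num)
  filter_upwards [hlim.eventually_lt_const (show 0 < η / 2 by positivity), hpos] with c hc hc0 B hB
  have hgci : Integrable (fun x => c ^ Module.finrank ℝ E * g (c • x)) vol :=
    (hgi.comp_smul hc0.ne').const_mul _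
  have hsmul : ∫ x in c • B, g x ∂vol = ∫ x in B, c ^ Module.finrank ℝ E * g (c • x) ∂vol := by
    rw [integral_const_mul, Measure.setIntegral_comp_smul_of_pos vol g B hc0, smul_eq_mul,
      mul_inv_cancel_left₀ (by positivity)]
  have hdiff : ∫ x in c • B, g x ∂vol - ∫ x in B, g x ∂vol ≤ η / 2 := by
    rw [hsmul, ← integral_sub hgci.integrableOn hgi.integrableOn]
    refine (Real.le_norm_self _).trans ((norm_integral_le_integral_norm _).trans (le_trans ?_ hc.le))
    exact setIntegral_le_integral (hgci.sub hgi).norm (ae_of_all _ fun _ => norm_nonneg _)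
  have h1 := (abs_le.1 (happrox (c • B))).2
  have h2 := (abs_le.1 (happrox B)).1
  linarith

end Dilation

/-! ### Discretization and partial couplings. -/

theorem exists_finite_cells {E : Type*} [PseudoMetricSpace E] [SecondCountableTopology E]
    [Nonempty E] [MeasurableSpace E] [BorelSpace E] (μ : Measure E) [IsFiniteMeasure μ]
    {δ η : ℝ} (hδ : 0 < δ) (hη : 0 < η) :
    ∃ (n : ℕ) (P : Fin n → Set E), (∀ i, MeasurableSet (P i)) ∧ Pairwise (Function.onFun Disjoint P) ∧
      (∀ i, ∀ x ∈ P i, ∀ y ∈ P i, dist x y ≤ δ) ∧ μ.real (⋃ i, P i)ᶜ ≤ η := by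
  let U : ℕ → Set E := fun k => ball (TopologicalSpace.denseSeq E k) (δ / 2)
  have hU : ⋃ k, disjointed U k = univ := by
    rw [iUnion_disjointed]
    refine eq_univ_of_forall fun x => ?_
    obtain ⟨k, hk⟩ := (TopologicalSpace.denseRange_denseSeq E).exists_dist_lt x (half_pos hδ)
    exact mem_iUnion.2 ⟨k, hk⟩
  have hUm (k) : MeasurableSet (disjointed U k) :=
    MeasurableSet.disjointed (fun _ => measurableSet_ball) k
  let T : ℕ → Set E := fun n => (⋃ i : Fin n, disjointed U i)ᶜ
  have hanti : Antitone T := by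
    intro m n hmn
    refine compl_subset_compl.2 (iUnion_subset fun i => ?_)
    exact subset_iUnion (fun i : Fin n => disjointed U i) (Fin.castLE hmn i)
  have hT : ⋂ n, T n = ∅ := by
    refine eq_empty_of_forall_notMem fun x hx => ?_
    obtain ⟨k, hk⟩ := mem_iUnion.1 (hU.symm ▸ mem_univ x : x ∈ ⋃ k, disjointed U k)
    exact mem_iInter.1 hx (k + 1) (mem_iUnion.2 ⟨⟨k, k.lt_succ_self⟩, hk⟩)
  have hlim := tendsto_measure_iInter_atTop (μ := μ)
    (fun n => (MeasurableSet.iUnion fun i : Fin n => hUm i).compl.nullMeasurableSet)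
    hanti ⟨0, measure_ne_top _ _⟩
  change Tendsto _ _ (𝓝 (μ (⋂ n, T n))) at hlim
  rw [hT, measure_empty] at hlim
  obtain ⟨n, hn⟩ := (hlim.eventually_lt_const (ENNReal.ofReal_pos.2 hη)).exists
  refine ⟨n, fun i => disjointed U i, fun i => hUm i, fun i j hij => ?_, fun i x hx y hy => ?_, ?_⟩
  · exact disjoint_disjointed U (fun h => hij (Fin.ext h))
  · have hx' := disjointed_subset U i hx
    have hy' := disjointed_subset U i hy
    rw [mem_ball] at hx' hy'
    have := dist_triangle_right x y (TopologicalSpace.denseSeq E i)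
    linarith
  · exact ENNReal.toReal_le_of_le_ofReal hη.le hn.le

theorem exists_measure_of_matching {E I : Type*} [MeasurableSpace E] [Fintype I]
    (μ μ' : Measure E) [IsFiniteMeasure μ] [IsFiniteMeasure μ'] {P : I → Set E}
    (hP : ∀ i, MeasurableSet (P i)) (hd : Pairwise (Function.onFun Disjoint P)) {r : I → I → Prop}
    {p : I → I → ℝ} (hp : p ∈ matchings (fun i => μ.real (P i)) (fun i => μ'.real (P i)) r) :
    ∃ γ : Measure (E × E), γ.map Prod.fst ≤ μ ∧ γ.map Prod.snd ≤ μ' ∧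
      (∀ T, (∀ i j, r i j → Disjoint (P i ×ˢ P j) T) → MeasurableSet T → γ T = 0) ∧
      γ univ = ENNReal.ofReal (∑ i, ∑ j, p i j) := by
  obtain ⟨hp0, hpr, hpa, hpb⟩ := hp
  set a : I → ℝ := fun i => μ.real (P i)
  set b : I → ℝ := fun i => μ'.real (P i)
  have ha (i) : μ (P i) = ENNReal.ofReal (a i) := by simp [a, measureReal_def]
  have hb (i) : μ' (P i) = ENNReal.ofReal (b i) := by simp [b, measureReal_def]
  have ha0 (i) : 0 ≤ a i := measureReal_nonneg
  have hb0 (i) : 0 ≤ b i := measureReal_nonneg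
  have hpa' (i j) : p i j ≤ a i :=
    (Finset.single_le_sum (f := fun j => p i j) (fun j _ => hp0 i j) (Finset.mem_univ j)).trans
      (hpa i)
  have hpb' (i j) : p i j ≤ b j :=
    (Finset.single_le_sum (f := fun i => p i j) (fun i _ => hp0 i j) (Finset.mem_univ i)).trans
      (hpb j)
  -- The mass `p i j` is spread over `P i ×ˢ P j` as a normalized product. If `a i * b j = 0`, then
  -- `p i j = 0`, so division by zero loses no mass.
  let γ : Measure (E × E) := ∑ i, ∑ j, ENNReal.ofReal (p i j / (a i * b j)) •
    (μ.restrict (P i)).prod (μ'.restrict (P j))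
  have hγ (T : Set (E × E)) : γ T = ∑ i, ∑ j, ENNReal.ofReal (p i j / (a i * b j)) *
      (μ.restrict (P i)).prod (μ'.restrict (P j)) T := by
    simp [γ, Measure.finsetSum_apply]
  have hsum (κ : Measure E) (s : Set E) (hs : MeasurableSet s) : ∑ i, κ (s ∩ P i) ≤ κ s := by
    rw [← measure_biUnion_finset (fun i _ j _ hij =>
      (hd hij).mono inter_subset_right inter_subset_right) (fun i _ => hs.inter (hP i))]
    exact measure_mono (iUnion₂_subset fun i _ => inter_subset_left)
  have hrow (i) : ∑ j, ENNReal.ofReal (p i j / (a i * b j)) * μ' (P j) ≤ 1 := by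
    calc ∑ j, ENNReal.ofReal (p i j / (a i * b j)) * μ' (P j)
        ≤ ∑ j, ENNReal.ofReal (p i j / a i) := by
          refine Finset.sum_le_sum fun j _ => ?_
          rw [hb, ← ENNReal.ofReal_mul (div_nonneg (hp0 i j) (mul_nonneg (ha0 i) (hb0 j)))]
          refine ENNReal.ofReal_le_ofReal ?_
          rcases (hb0 j).eq_or_lt with h | h
          · rw [← h, mul_zero]
            exact div_nonneg (hp0 i j) (ha0 i)
          · rw [← div_div, div_mul_cancel₀ _ h.ne']
      _ = ENNReal.ofReal ((∑ j, p i j) / a i) := by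
          rw [← ENNReal.ofReal_sum_of_nonneg fun j _ => div_nonneg (hp0 i j) (ha0 i),
            Finset.sum_div]
      _ ≤ 1 := ENNReal.ofReal_le_one.2 (div_le_one_of_le₀ (hpa i) (ha0 i))
  have hcol (j) : ∑ i, ENNReal.ofReal (p i j / (a i * b j)) * μ (P i) ≤ 1 := by
    calc ∑ i, ENNReal.ofReal (p i j / (a i * b j)) * μ (P i)
        ≤ ∑ i, ENNReal.ofReal (p i j / b j) := by
          refine Finset.sum_le_sum fun i _ => ?_
          rw [ha, ← ENNReal.ofReal_mul (div_nonneg (hp0 i j) (mul_nonneg (ha0 i) (hb0 j)))]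
          refine ENNReal.ofReal_le_ofReal ?_
          rcases (ha0 i).eq_or_lt with h | h
          · rw [← h, mul_zero]
            exact div_nonneg (hp0 i j) (hb0 j)
          · rw [mul_comm (a i), ← div_div, div_mul_cancel₀ _ h.ne']
      _ = ENNReal.ofReal ((∑ i, p i j) / b j) := by
          rw [← ENNReal.ofReal_sum_of_nonneg fun i _ => div_nonneg (hp0 i j) (hb0 j),
            Finset.sum_div]
      _ ≤ 1 := ENNReal.ofReal_le_one.2 (div_le_one_of_le₀ (hpb j) (hb0 j))
  refine ⟨γ, Measure.le_iff.2 fun s hs => ?_, Measure.le_iff.2 fun s hs => ?_,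
    fun T hT hTm => ?_, ?_⟩
  · rw [Measure.map_apply measurable_fst hs, ← prod_univ, hγ]
    simp only [Measure.prod_prod, Measure.restrict_apply hs, Measure.restrict_apply_univ]
    refine le_trans (Finset.sum_le_sum fun i _ => ?_) (hsum μ s hs)
    calc ∑ j, ENNReal.ofReal (p i j / (a i * b j)) * (μ (s ∩ P i) * μ' (P j))
        = μ (s ∩ P i) * ∑ j, ENNReal.ofReal (p i j / (a i * b j)) * μ' (P j) := by
          rw [Finset.mul_sum]
          exact Finset.sum_congr rfl fun j _ => by ring
      _ ≤ μ (s ∩ P i) * 1 := by gcongr; exact hrow i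
      _ = μ (s ∩ P i) := mul_one _
  · rw [Measure.map_apply measurable_snd hs, ← univ_prod, hγ, Finset.sum_comm]
    simp only [Measure.prod_prod, Measure.restrict_apply hs, Measure.restrict_apply_univ]
    refine le_trans (Finset.sum_le_sum fun j _ => ?_) (hsum μ' s hs)
    calc ∑ i, ENNReal.ofReal (p i j / (a i * b j)) * (μ (P i) * μ' (s ∩ P j))
        = μ' (s ∩ P j) * ∑ i, ENNReal.ofReal (p i j / (a i * b j)) * μ (P i) := by
          rw [Finset.mul_sum]
          exact Finset.sum_congr rfl fun i _ => by ring
      _ ≤ μ' (s ∩ P j) * 1 := by gcongr; exact hcol j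
      _ = μ' (s ∩ P j) := mul_one _
  · rw [hγ]
    refine Finset.sum_eq_zero fun i _ => Finset.sum_eq_zero fun j _ => ?_
    by_cases hr : r i j
    · rw [Measure.prod_restrict, Measure.restrict_apply hTm, (hT i j hr).symm.inter_eq,
        measure_empty, mul_zero]
    · simp [hpr i j hr]
  · rw [hγ, ENNReal.ofReal_sum_of_nonneg fun i _ => Finset.sum_nonneg fun j _ => hp0 i j]
    refine Finset.sum_congr rfl fun i _ => ?_
    rw [ENNReal.ofReal_sum_of_nonneg fun j _ => hp0 i j]
    refine Finset.sum_congr rfl fun j _ => ?_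
    rw [← univ_prod_univ, Measure.prod_prod, Measure.restrict_apply_univ,
      Measure.restrict_apply_univ, ha, hb, ← ENNReal.ofReal_mul (ha0 i),
      ← ENNReal.ofReal_mul (div_nonneg (hp0 i j) (mul_nonneg (ha0 i) (hb0 j)))]
    congr 1
    by_cases h : a i * b j = 0
    · have hpz : p i j = 0 := by
        refine le_antisymm ?_ (hp0 i j)
        rcases mul_eq_zero.1 h with h | h
        exacts [h ▸ hpa' i j, h ▸ hpb' i j]
      rw [hpz, zero_div, zero_mul]
    · rw [div_mul_cancel₀ _ h]

/-- Approximate Strassen duality for absolutely continuous finite measures. -/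
theorem exists_partial_coupling_of_pos {E : Type*} [NormedAddCommGroup E] [NormedSpace ℝ E]
    [FiniteDimensional ℝ E] [MeasurableSpace E] [BorelSpace E]
    {vol : Measure E} [vol.IsAddHaarMeasure] {μ μ' : Measure E} [IsFiniteMeasure μ]
    [IsFiniteMeasure μ'] (hμ : μ ≪ vol) (hμ' : μ' ≪ vol) {ε η : ℝ} (hε : 0 < ε) (hη : 0 < η) :
    ∃ (γ : Measure (E × E)) (A : Set E), MeasurableSet A ∧ γ.map Prod.fst ≤ μ ∧
      γ.map Prod.snd ≤ μ' ∧ γ {q | 2 * ε < dist q.1 q.2} = 0 ∧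
      μ.real (thickening ε A) + μ'.real (thickening ε Aᶜ) ≤ γ.real univ + η := by
  have hη4 : 0 < η / 4 := by positivity
  obtain ⟨c, ⟨hc, hc'⟩, hc1⟩ := (((eventually_measureReal_smul_le hμ hη4).and
    (eventually_measureReal_smul_le hμ' hη4)).filter_mono nhdsWithin_le_nhds |>.and
    (self_mem_nhdsWithin (s := Ioi (1 : ℝ)) (a := 1))).exists
  have hc1 : 1 < c := hc1
  have hc0 : 0 < c := by linarith
  have hεc : ε / c < ε := div_lt_self hε hc1
  -- The cell diameter `ε - ε / c` is chosen so that two cells and two steps of length `ε / c` add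
  -- up to `2ε`.
  obtain ⟨n, P, hPm, hPd, hPδ, hPη⟩ := exists_finite_cells (μ + μ') (sub_pos.2 hεc) hη4
  let r : Fin n → Fin n → Prop := fun i j => ∀ x ∈ P i, ∀ y ∈ P j, dist x y ≤ 2 * ε
  obtain ⟨p, hp, S, s, t, hs, ht, hst⟩ := exists_matching_ge_cover
    (a := fun i => μ.real (P i)) (b := fun i => μ'.real (P i))
    (fun i => measureReal_nonneg) (fun i => measureReal_nonneg) r
  obtain ⟨γ, hγ1, hγ2, hγ3, hγ4⟩ := exists_measure_of_matching μ μ' hPm hPd hp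
  have hres : μ.real (⋃ i, P i)ᶜ ≤ η / 4 ∧ μ'.real (⋃ i, P i)ᶜ ≤ η / 4 := by
    rw [measureReal_add_apply] at hPη
    constructor <;> linarith [measureReal_nonneg (μ := μ) (s := (⋃ i, P i)ᶜ),
      measureReal_nonneg (μ := μ') (s := (⋃ i, P i)ᶜ)]
  have hcover (κ : Measure E) [IsFiniteMeasure κ] (hκ : κ.real (⋃ i, P i)ᶜ ≤ η / 4)
      (u : Finset (Fin n)) (B : Set E) (hB : ∀ i, ∀ x ∈ P i, x ∈ B → i ∈ u) :
      κ.real B ≤ ∑ i ∈ u, κ.real (P i) + η / 4 := by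
    have hsub : B ⊆ (⋃ i ∈ u, P i) ∪ (⋃ i, P i)ᶜ := by
      intro x hx
      by_cases h : x ∈ ⋃ i, P i
      · obtain ⟨i, hi⟩ := mem_iUnion.1 h
        exact Or.inl (mem_iUnion₂.2 ⟨i, hB i x hi hx, hi⟩)
      · exact Or.inr h
    exact (measureReal_mono hsub).trans ((measureReal_union_le _ _).trans
      (add_le_add (measureReal_biUnion_finset_le _ _) hκ))
  let C : Set E := ⋃ i ∈ S, P i
  -- The thickening of `A'` avoids `C`, so it meets only cells of `s`. That of `A'ᶜ` lies within `2ε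
  -- / c` of `C`, so it meets only cells of `t`. Dilating by `c` then turns `ε / c` into `ε`. The
  -- uncovered remainder and the dilation cost `η / 4` each, for each measure.
  let A' : Set E := (thickening (ε / c) C)ᶜ
  have hA'm : MeasurableSet A' := isOpen_thickening.measurableSet.compl
  have h1 : μ.real (thickening (ε / c) A') ≤ ∑ i ∈ s, μ.real (P i) + η / 4 := by
    refine hcover μ hres.1 s _ fun i x hi hx => (hs i).2 fun hiS => ?_
    obtain ⟨m, hm, hxm⟩ := mem_thickening_iff.1 hx
    exact hm (mem_thickening_iff.2 ⟨x, mem_iUnion₂.2 ⟨i, hiS, hi⟩, by rwa [dist_comm]⟩)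
  have h2 : μ'.real (thickening (ε / c) A'ᶜ) ≤ ∑ j ∈ t, μ'.real (P j) + η / 4 := by
    refine hcover μ' hres.2 t _ fun j y hj hy => (ht j).2 ?_
    obtain ⟨m, hm, hym⟩ := mem_thickening_iff.1 hy
    rw [compl_compl] at hm
    obtain ⟨z, hz, hmz⟩ := mem_thickening_iff.1 hm
    obtain ⟨i, hiS, hzi⟩ := mem_iUnion₂.1 hz
    refine ⟨i, hiS, fun x' hx' y' hy' => ?_⟩
    have e1 := hPδ i x' hx' z hzi
    have e2 := hPδ j y hj y' hy'
    have e3 := dist_triangle4 x' z y y'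
    have e4 := dist_triangle z m y
    rw [dist_comm z m, dist_comm m y] at e4
    linarith
  have hscale (B : Set E) : thickening ε (c • B) ⊆ c • thickening (ε / c) B := by
    intro x hx
    obtain ⟨_, ⟨m, hm, rfl⟩, hxm⟩ := mem_thickening_iff.1 hx
    refine ⟨c⁻¹ • x, mem_thickening_iff.2 ⟨m, hm, ?_⟩, smul_inv_smul₀ hc0.ne' x⟩
    rw [lt_div_iff₀' hc0]
    calc c * dist (c⁻¹ • x) m = dist (c • c⁻¹ • x) (c • m) := by
          rw [dist_smul₀, Real.norm_of_nonneg hc0.le]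
      _ < ε := by rwa [smul_inv_smul₀ hc0.ne']
  refine ⟨γ, c • A', hA'm.const_smul₀ c, hγ1, hγ2, hγ3 _ (fun i j hr => ?_) ?_, ?_⟩
  · refine disjoint_left.2 fun q hq hq' => ?_
    exact absurd (hr _ hq.1 _ hq.2) (not_le.2 hq')
  · exact (isOpen_lt continuous_const (continuous_fst.dist continuous_snd)).measurableSet
  · have hγu : γ.real univ = ∑ i, ∑ j, p i j := by
      rw [measureReal_def, hγ4, ENNReal.toReal_ofReal
        (Finset.sum_nonneg fun i _ => Finset.sum_nonneg fun j _ => hp.1 i j)]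
    have h3 := (measureReal_mono (μ := μ) (hscale A')).trans
      (hc _ isOpen_thickening.measurableSet)
    have h4 := (measureReal_mono (μ := μ') (hscale A'ᶜ)).trans
      (hc' _ isOpen_thickening.measurableSet)
    have hcompl : c • A'ᶜ = (c • A')ᶜ := by
      ext x
      simp [mem_smul_set_iff_inv_smul_mem₀ hc0.ne']
    rw [hcompl] at h4
    rw [hγu]
    linarith

/-- A Hahn set `A`, on which `μ ≤ μ'` with the reverse on `Aᶜ`, gives the minimum of the two
measures; `γ` is this minimum placed on the diagonal. -/
theorem exists_partial_coupling_zero {E : Type*} [MetricSpace E] [SecondCountableTopology E]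
    [MeasurableSpace E] [BorelSpace E] (μ μ' : Measure E) [IsFiniteMeasure μ]
    [IsFiniteMeasure μ'] :
    ∃ (γ : Measure (E × E)) (A : Set E), MeasurableSet A ∧ γ.map Prod.fst ≤ μ ∧
      γ.map Prod.snd ≤ μ' ∧ γ {q | 0 < dist q.1 q.2} = 0 ∧
      μ.real A + μ'.real Aᶜ = γ.real univ := by
  obtain ⟨s, hs, h1, h2⟩ := exists_isHahnDecomposition μ μ'
  have hdiag : Measurable fun x : E => (x, x) := by fun_prop
  have hfst : (Prod.fst ∘ fun x : E => (x, x)) = id := rfl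
  have hsnd : (Prod.snd ∘ fun x : E => (x, x)) = id := rfl
  refine ⟨(μ.restrict s + μ'.restrict sᶜ).map fun x => (x, x), s, hs, ?_, ?_, ?_, ?_⟩
  · rw [Measure.map_map measurable_fst hdiag, hfst, Measure.map_id]
    nth_rw 2 [← Measure.restrict_add_restrict_compl (μ := μ) hs]
    exact add_le_add le_rfl h2
  · rw [Measure.map_map measurable_snd hdiag, hsnd, Measure.map_id]
    nth_rw 2 [← Measure.restrict_add_restrict_compl (μ := μ') hs]
    exact add_le_add h1 le_rfl
  · rw [Measure.map_apply hdiag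
      (isOpen_lt continuous_const (continuous_fst.dist continuous_snd)).measurableSet]
    simp
  · rw [measureReal_def _ univ, Measure.map_apply hdiag MeasurableSet.univ]
    simp [measureReal_def, ENNReal.toReal_add]

theorem exists_partial_coupling {E : Type*} [NormedAddCommGroup E] [NormedSpace ℝ E]
    [FiniteDimensional ℝ E] [MeasurableSpace E] [BorelSpace E]
    {vol : Measure E} [vol.IsAddHaarMeasure] {μ μ' : Measure E} [IsFiniteMeasure μ]
    [IsFiniteMeasure μ'] (hμ : μ ≪ vol) (hμ' : μ' ≪ vol) {ε η : ℝ} (hε : 0 ≤ ε) (hη : 0 < η) :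
    ∃ (γ : Measure (E × E)) (A : Set E), MeasurableSet A ∧ γ.map Prod.fst ≤ μ ∧
      γ.map Prod.snd ≤ μ' ∧ γ {q | 2 * ε < dist q.1 q.2} = 0 ∧
      μ.real (reach ε A) + μ'.real (reach ε Aᶜ) ≤ γ.real univ + η := by
  rcases hε.eq_or_lt with rfl | hε'
  · obtain ⟨γ, A, hA, h1, h2, h3, h4⟩ := exists_partial_coupling_zero μ μ'
    refine ⟨γ, A, hA, h1, h2, by simpa using h3, ?_⟩
    rw [← measureReal_congr (reach_ae_eq hμ le_rfl A), ← measureReal_congr (reach_ae_eq hμ' le_rfl Aᶜ)]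
    simp only [thickening_of_nonpos le_rfl, union_empty]
    linarith
  · obtain ⟨γ, A, hA, h1, h2, h3, h4⟩ := exists_partial_coupling_of_pos hμ hμ' hε' hη
    refine ⟨γ, A, hA, h1, h2, h3, ?_⟩
    rw [← measureReal_congr (reach_ae_eq hμ hε A), ← measureReal_congr (reach_ae_eq hμ' hε Aᶜ),
      union_eq_self_of_subset_left (self_subset_thickening hε' A),
      union_eq_self_of_subset_left (self_subset_thickening hε' Aᶜ)]
    exact h4

/-- The two marginal deficits have the same mass, so their normalized product fills them both. When
that mass is zero, the deficits vanish and the infinite factor is harmless. -/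
theorem exists_coupling_ge {Z : Type*} [MeasurableSpace Z] {μ μ' : Measure Z}
    [IsProbabilityMeasure μ] [IsProbabilityMeasure μ'] {γ : Measure (Z × Z)}
    (h₁ : γ.map Prod.fst ≤ μ) (h₂ : γ.map Prod.snd ≤ μ') :
    ∃ π ∈ Couplings μ μ', γ ≤ π := by
  have hf₁ : IsFiniteMeasure (γ.map Prod.fst) := isFiniteMeasure_of_le μ h₁
  have hf₂ : IsFiniteMeasure (γ.map Prod.snd) := isFiniteMeasure_of_le μ' h₂
  have hu₁ : (γ.map Prod.fst) univ = γ univ := by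
    rw [Measure.map_apply measurable_fst MeasurableSet.univ, preimage_univ]
  have hu₂ : (γ.map Prod.snd) univ = γ univ := by
    rw [Measure.map_apply measurable_snd MeasurableSet.univ, preimage_univ]
  set α := μ - γ.map Prod.fst with hα
  set β := μ' - γ.map Prod.snd with hβ
  have hαu : α univ = 1 - γ univ := by
    rw [hα, Measure.sub_apply MeasurableSet.univ h₁, measure_univ, hu₁]
  have hβu : β univ = 1 - γ univ := by
    rw [hβ, Measure.sub_apply MeasurableSet.univ h₂, measure_univ, hu₂]
  have hmt : 1 - γ univ ≠ ∞ := ENNReal.sub_ne_top ENNReal.one_ne_top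
  have hscale (κ : Measure Z) (hκ : κ univ = 1 - γ univ) :
      (1 - γ univ)⁻¹ • ((1 - γ univ) • κ) = κ := by
    by_cases h0 : 1 - γ univ = 0
    · rw [h0, Measure.measure_univ_eq_zero.1 (hκ.trans h0), smul_zero, smul_zero]
    · rw [smul_smul, ENNReal.inv_mul_cancel h0 hmt, one_smul]
  refine ⟨γ + (1 - γ univ)⁻¹ • α.prod β, ⟨?_, ?_⟩, Measure.le_add_right le_rfl⟩
  · rw [Measure.map_add _ _ measurable_fst, Measure.map_smul, Measure.map_fst_prod, hβu,
      hscale α hαu, add_comm, hα, Measure.sub_add_cancel_of_le h₁]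
  · rw [Measure.map_add _ _ measurable_snd, Measure.map_smul, Measure.map_snd_prod, hαu,
      hscale β hβu, add_comm, hβ, Measure.sub_add_cancel_of_le h₂]

/-! ### Label swapping. -/

section Swap

variable {E : Type*} [MeasurableSpace E]

theorem measurable_swapLabel :
    Measurable (fun z : E × Fin 2 => (z.1, Equiv.swap (0 : Fin 2) 1 z.2)) :=
  measurable_fst.prodMk ((measurable_of_finite _).comp measurable_snd)

theorem labelMeasure_swapLabels (ν : Measure (E × Fin 2)) (y : Fin 2) :
    labelMeasure (swapLabels ν) y = labelMeasure ν (Equiv.swap 0 1 y) := by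
  ext B hB
  rw [labelMeasure_apply _ _ hB, labelMeasure_apply _ _ hB, swapLabels,
    Measure.map_apply measurable_swapLabel (hB.prod (measurableSet_singleton y))]
  congr 1
  ext ⟨x, y'⟩
  simp [Equiv.swap_apply_eq_iff]

instance (ν : Measure (E × Fin 2)) [IsProbabilityMeasure ν] :
    IsProbabilityMeasure (swapLabels ν) :=
  Measure.isProbabilityMeasure_map measurable_swapLabel.aemeasurable

theorem measure_prod_singleton_le (ν : Measure (E × Fin 2)) (y : Fin 2) (B : Set E) :
    ν (B ×ˢ {y}) ≤ labelMeasure ν y B :=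
  (Measure.le_restrict_apply (Prod.snd ⁻¹' {y}) (Prod.fst ⁻¹' B)).trans
    (Measure.le_map_apply measurable_fst.aemeasurable B)

theorem map_labelMeasure_add (ν : Measure (E × Fin 2)) :
    (labelMeasure ν 0).map (fun x => (x, (0 : Fin 2)))
      + (labelMeasure ν 1).map (fun x => (x, (1 : Fin 2))) = ν := by
  ext L hL
  rw [measure_eq_labelMeasure_add ν hL, Measure.add_apply,
    Measure.map_apply (by fun_prop) hL, Measure.map_apply (by fun_prop) hL]
  rfl

end Swap

/-! ### Weak duality, and lifting partial couplings to labelled points. -/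

section Duality

variable {E : Type*} [NormedAddCommGroup E] [MeasurableSpace E] [BorelSpace E]

/-- The pairs of labelled points that cannot be matched at zero cost. -/
def farPairs (E : Type*) [PseudoMetricSpace E] (ε : ℝ) : Set ((E × Fin 2) × (E × Fin 2)) :=
  {p | 2 * ε < dist p.1.1 p.2.1 ∨ p.1.2 ≠ p.2.2}

theorem measurableSet_farPairs [SecondCountableTopology E] (ε : ℝ) :
    MeasurableSet (farPairs E ε) := by
  refine MeasurableSet.union ?_ ?_
  · exact measurableSet_lt measurable_const
      ((measurable_fst.comp measurable_fst).dist (measurable_fst.comp measurable_snd))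
  · exact (measurableSet_eq_fun (measurable_snd.comp measurable_fst)
      (measurable_snd.comp measurable_snd)).compl

theorem integral_cost [SecondCountableTopology E] (ε : ℝ)
    (π : Measure ((E × Fin 2) × (E × Fin 2))) :
    ∫ p, cost ε p ∂π = π.real (farPairs E ε) := by
  rw [← integral_indicator_one (measurableSet_farPairs ε)]
  congr 1
  ext p
  classical
  rw [indicator_apply]
  exact if_congr Iff.rfl rfl rfl

theorem isProbabilityMeasure_of_mem_couplings {Z : Type*} [MeasurableSpace Z] {μ μ' : Measure Z}
    [IsProbabilityMeasure μ] {π : Measure (Z × Z)} (hπ : π ∈ Couplings μ μ') :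
    IsProbabilityMeasure π := by
  constructor
  rw [← preimage_univ (f := Prod.fst), ← Measure.map_apply measurable_fst MeasurableSet.univ, hπ.1,
    measure_univ]

theorem one_sub_integral_cost_le [NormedSpace ℝ E] [SecondCountableTopology E]
    {ν : Measure (E × Fin 2)} [IsProbabilityMeasure ν] (ε : ℝ)
    {π : Measure ((E × Fin 2) × (E × Fin 2))} (hπ : π ∈ Couplings ν (swapLabels ν)) (A : Set E) :
    1 - ∫ p, cost ε p ∂π ≤
      2 * ((labelMeasure ν 0).real (reach ε A) + (labelMeasure ν 1).real (reach ε Aᶜ)) := by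
  have hp := isProbabilityMeasure_of_mem_couplings hπ
  rw [integral_cost, ← probReal_compl_eq_one_sub (measurableSet_farPairs ε)]
  -- The cases are the common label and the side of `A` on which the midpoint falls. Since the
  -- second marginal has swapped labels, each of the two terms of the risk is charged twice, whence
  -- the factor 2.
  have hsub : (farPairs E ε)ᶜ ⊆
      ((Prod.fst ⁻¹' (reach ε A ×ˢ {0})) ∪ (Prod.snd ⁻¹' (reach ε Aᶜ ×ˢ {0}))) ∪
      ((Prod.fst ⁻¹' (reach ε Aᶜ ×ˢ {1})) ∪ (Prod.snd ⁻¹' (reach ε A ×ˢ {1}))) := by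
    rintro ⟨⟨x, y⟩, ⟨x', y'⟩⟩ h
    simp only [farPairs, mem_compl_iff, mem_ofPred_eq, not_or, not_lt, not_not] at h
    obtain ⟨hd, rfl⟩ := h
    have hmx : dist (midpoint ℝ x x') x ≤ ε := by
      rw [dist_midpoint_left, Real.norm_of_nonneg zero_le_two]
      linarith
    have hmx' : dist (midpoint ℝ x x') x' ≤ ε := by
      rw [dist_midpoint_right, Real.norm_of_nonneg zero_le_two]
      linarith
    by_cases hm : midpoint ℝ x x' ∈ A <;> fin_cases y
    · exact Or.inl (Or.inl ⟨⟨_, hm, hmx⟩, rfl⟩)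
    · exact Or.inr (Or.inr ⟨⟨_, hm, hmx'⟩, rfl⟩)
    · exact Or.inl (Or.inr ⟨⟨_, hm, hmx'⟩, rfl⟩)
    · exact Or.inr (Or.inl ⟨⟨_, hm, hmx⟩, rfl⟩)
  have hfst (B : Set E) (y : Fin 2) :
      π.real (Prod.fst ⁻¹' (B ×ˢ {y})) ≤ (labelMeasure ν y).real B := by
    refine ENNReal.toReal_mono (measure_ne_top _ _) ?_
    refine (Measure.le_map_apply measurable_fst.aemeasurable _).trans ?_
    rw [hπ.1]
    exact measure_prod_singleton_le ν y B
  have hsnd (B : Set E) (y : Fin 2) :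
      π.real (Prod.snd ⁻¹' (B ×ˢ {y})) ≤ (labelMeasure ν (Equiv.swap 0 1 y)).real B := by
    refine ENNReal.toReal_mono (measure_ne_top _ _) ?_
    refine (Measure.le_map_apply measurable_snd.aemeasurable _).trans ?_
    rw [hπ.2, ← labelMeasure_swapLabels]
    exact measure_prod_singleton_le _ y B
  have h1 := hfst (reach ε A) 0
  have h2 := hsnd (reach ε Aᶜ) 0
  have h3 := hfst (reach ε Aᶜ) 1
  have h4 := hsnd (reach ε A) 1
  rw [Equiv.swap_apply_left] at h2
  rw [Equiv.swap_apply_right] at h4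
  have h5 := (measureReal_mono (μ := π) hsub).trans ((measureReal_union_le _ _).trans
    (add_le_add (measureReal_union_le _ _) (measureReal_union_le _ _)))
  linarith

/-- One copy of `γ` carries label 0 and a reversed copy carries label 1. Both are free of cost and
fit under the marginals, so the completed coupling has zero cost on mass at least twice that of `γ`.
-/
theorem exists_coupling_of_partial [SecondCountableTopology E] {ν : Measure (E × Fin 2)}
    [IsProbabilityMeasure ν] {ε : ℝ} {γ : Measure (E × E)}
    (h₁ : γ.map Prod.fst ≤ labelMeasure ν 0) (h₂ : γ.map Prod.snd ≤ labelMeasure ν 1)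
    (h₃ : γ {q | 2 * ε < dist q.1 q.2} = 0) :
    ∃ π ∈ Couplings ν (swapLabels ν), ∫ p, cost ε p ∂π ≤ 1 - 2 * γ.real univ := by
  let f₀ : E × E → (E × Fin 2) × (E × Fin 2) := fun q => ((q.1, 0), (q.2, 0))
  let f₁ : E × E → (E × Fin 2) × (E × Fin 2) := fun q => ((q.2, 1), (q.1, 1))
  have hf₀ : Measurable f₀ := by fun_prop
  have hf₁ : Measurable f₁ := by fun_prop
  have hι (y : Fin 2) : Measurable fun x : E => (x, y) := by fun_prop
  have hfst : (γ.map f₀ + γ.map f₁).map Prod.fst ≤ ν := by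
    rw [Measure.map_add _ _ measurable_fst, Measure.map_map measurable_fst hf₀,
      Measure.map_map measurable_fst hf₁]
    change γ.map ((fun x => (x, (0 : Fin 2))) ∘ Prod.fst)
      + γ.map ((fun x => (x, (1 : Fin 2))) ∘ Prod.snd) ≤ ν
    rw [← Measure.map_map (hι 0) measurable_fst, ← Measure.map_map (hι 1) measurable_snd]
    conv_rhs => rw [← map_labelMeasure_add ν]
    exact add_le_add (Measure.map_mono h₁ (hι 0)) (Measure.map_mono h₂ (hι 1))
  have hsnd : (γ.map f₀ + γ.map f₁).map Prod.snd ≤ swapLabels ν := by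
    rw [Measure.map_add _ _ measurable_snd, Measure.map_map measurable_snd hf₀,
      Measure.map_map measurable_snd hf₁]
    change γ.map ((fun x => (x, (0 : Fin 2))) ∘ Prod.snd)
      + γ.map ((fun x => (x, (1 : Fin 2))) ∘ Prod.fst) ≤ swapLabels ν
    rw [← Measure.map_map (hι 0) measurable_snd, ← Measure.map_map (hι 1) measurable_fst]
    conv_rhs => rw [← map_labelMeasure_add (swapLabels ν), labelMeasure_swapLabels,
      labelMeasure_swapLabels, Equiv.swap_apply_left, Equiv.swap_apply_right]
    exact add_le_add (Measure.map_mono h₂ (hι 0)) (Measure.map_mono h₁ (hι 1))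
  obtain ⟨π, hπ, hle⟩ := exists_coupling_ge hfst hsnd
  have hp := isProbabilityMeasure_of_mem_couplings hπ
  have hγt : γ univ ≠ ∞ := by
    have := (Measure.le_iff.1 h₁ univ MeasurableSet.univ).trans_lt (measure_lt_top _ _)
    rw [Measure.map_apply measurable_fst MeasurableSet.univ, preimage_univ] at this
    exact this.ne
  have hfin : IsFiniteMeasure γ := ⟨hγt.lt_top⟩
  refine ⟨π, hπ, ?_⟩
  have hgood : 2 * γ.real univ ≤ π.real (farPairs E ε)ᶜ := by
    have hmass : γ univ = γ {q | 2 * ε < dist q.1 q.2}ᶜ := by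
      refine le_antisymm ?_ (measure_mono (subset_univ _))
      rw [← union_compl_self {q : E × E | 2 * ε < dist q.1 q.2}]
      exact (measure_union_le _ _).trans_eq (by rw [h₃, zero_add])
    have hlow : γ univ + γ univ ≤ π (farPairs E ε)ᶜ := by
      refine le_trans ?_ (hle _)
      have hm := (measurableSet_farPairs (E := E) ε).compl
      rw [Measure.add_apply, Measure.map_apply hf₀ hm, Measure.map_apply hf₁ hm, hmass]
      refine add_le_add (measure_mono fun q hq => ?_) (measure_mono fun q hq => ?_)
      · simpa [farPairs, f₀] using hq
      · simpa [farPairs, f₁, dist_comm] using hq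
    rw [two_mul, measureReal_def, ← ENNReal.toReal_add hγt hγt]
    exact ENNReal.toReal_mono (measure_ne_top _ _) hlow
  rw [integral_cost]
  rw [probReal_compl_eq_one_sub (measurableSet_farPairs ε)] at hgood
  linarith

end Duality

end AdvRisk

theorem mainTheorem3 {E : Type*} [NormedAddCommGroup E] [NormedSpace ℝ E]
    [FiniteDimensional ℝ E] [MeasurableSpace E] [BorelSpace E]
    (vol : Measure E) [vol.IsAddHaarMeasure]
    (ν : Measure (E × Fin 2)) [IsProbabilityMeasure ν]
    (ρ₀ ρ₁ : E → ℝ)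
    (hρ₀ : AdvRisk.IsCondDensity vol ν 0 ρ₀)
    (hρ₁ : AdvRisk.IsCondDensity vol ν 1 ρ₁)
    (ε : ℝ) (hε : 0 ≤ ε) :
    (0 < ε → ∀ A : Set E, MeasurableSet A →
      (IsMinOn (fun B : Set E => AdvRisk.robustRisk ν ε (AdvRisk.classifier B))
          {B | MeasurableSet B} A ↔
        IsMaxOn (fun B : Set E =>
            AdvRisk.labelWeight ν 1 * ∫ x in AdvRisk.offset B (-ε), ρ₁ x ∂vol
              - AdvRisk.labelWeight ν 0 * ∫ x in AdvRisk.offset B ε, ρ₀ x ∂vol)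
          {B | MeasurableSet B} A)) ∧
    (⨅ A : {A : Set E // MeasurableSet A}, AdvRisk.robustRisk ν ε (AdvRisk.classifier A.1))
      = 1 / 2 - 1 / 2 * (⨅ π : AdvRisk.Couplings ν (AdvRisk.swapLabels ν),
          ∫ p, AdvRisk.cost ε p ∂π.1) := by
  have hν : ∀ y, AdvRisk.labelMeasure ν y ≪ vol := by
    intro y
    fin_cases y
    exacts [hρ₀.absolutelyContinuous, hρ₁.absolutelyContinuous]
  refine ⟨fun hε' A hA => ?_, ?_⟩
  · simp only [isMinOn_iff, isMaxOn_iff]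
    refine forall₂_congr fun B hB => ?_
    rw [AdvRisk.robustRisk_eq_sub hρ₀ hρ₁ hε' hA, AdvRisk.robustRisk_eq_sub hρ₀ hρ₁ hε' hB]
    exact sub_le_sub_iff_left _
  have hrisk (A : {A : Set E // MeasurableSet A}) := AdvRisk.robustRisk_eq hν hε A.2
  have hbddR : BddBelow (range fun A : {A : Set E // MeasurableSet A} =>
      AdvRisk.robustRisk ν ε (AdvRisk.classifier A.1)) :=
    ⟨0, forall_mem_range.2 fun A => by rw [hrisk]; positivity⟩
  have hbddK : BddBelow (range fun π : AdvRisk.Couplings ν (AdvRisk.swapLabels ν) =>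
      ∫ p, AdvRisk.cost ε p ∂π.1) :=
    ⟨0, forall_mem_range.2 fun π => by rw [AdvRisk.integral_cost]; positivity⟩
  have hneR : Nonempty {A : Set E // MeasurableSet A} := ⟨⟨∅, MeasurableSet.empty⟩⟩
  have hneK : Nonempty (AdvRisk.Couplings ν (AdvRisk.swapLabels ν)) :=
    ⟨⟨ν.prod (AdvRisk.swapLabels ν), by simp [AdvRisk.Couplings]⟩⟩
  set I := ⨅ A : {A : Set E // MeasurableSet A}, AdvRisk.robustRisk ν ε (AdvRisk.classifier A.1)
  set K := ⨅ π : AdvRisk.Couplings ν (AdvRisk.swapLabels ν), ∫ p, AdvRisk.cost ε p ∂π.1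
  have hweak : 1 - 2 * I ≤ K := by
    refine le_ciInf fun π => ?_
    have : (1 - ∫ p, AdvRisk.cost ε p ∂π.1) / 2 ≤ I := by
      refine le_ciInf fun A => ?_
      rw [hrisk]
      linarith [AdvRisk.one_sub_integral_cost_le ε π.2 A.1]
    linarith
  have hstrong : K ≤ 1 - 2 * I := by
    refine le_of_forall_pos_le_add fun η hη => ?_
    -- The tolerance is `η / 2` because `γ` is counted twice in the coupling.
    obtain ⟨γ, A, hA, h1, h2, h3, h4⟩ :=
      AdvRisk.exists_partial_coupling (hν 0) (hν 1) hε (half_pos hη)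
    obtain ⟨π, hπ, hcost⟩ := AdvRisk.exists_coupling_of_partial h1 h2 h3
    have hK : K ≤ ∫ p, AdvRisk.cost ε p ∂π := ciInf_le hbddK ⟨π, hπ⟩
    have hI : I ≤ AdvRisk.robustRisk ν ε (AdvRisk.classifier A) := ciInf_le hbddR ⟨A, hA⟩
    rw [AdvRisk.robustRisk_eq hν hε hA] at hI
    linarith
  linarith
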